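/- Let $n,k$ be integers with $1\le k\le n$ and let $h>0$. Let $\mathrm{crosspol}(k,h)$ be the class of all origin-symmetric cross-polytopes $T\subset\mathbb{R}^n$ that can be written as $T=\mathrm{conv}\{\pm x_1,\dots,\pm x_n\}$ with vectors $x_1,\dots,x_n\in\mathbb{R}^n$ such that, for every permutation $\sigma$ of $\{1,\dots,n\}$, $$\Big|\Big\{i:\ n-k+1\le i\le n,\ \mathrm{dist}\big(x_{\sigma(i)},\,\mathrm{span}\{x_{\sigma(j)}:\ j<i\}\big)\le h\Big\}\Big|\ \ge\ \frac{k}{4},$$ where $\mathrm{dist}$ is the Euclidean distance; the cross-polytope may be degenerate, that is, the $x_i$ need not be linearly independent. Let $\gamma_n$ be the standard Gaussian measure on $\mathbb{R}^n$. There is a universal constant $c>0$ such that for all integers $1\le k\le n$, every real $h$ with $0<h\le cn$, and every $P=\mathrm{conv}\{\pm x_1,\dots,\pm x_n\}\in\mathrm{crosspol}(k,h)$, $$\gamma_n(P)\le 2e^{-ck}.$$ -/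

import Mathlib

open MeasureTheory ProbabilityTheory

/-- The absolutely convex polytope `conv {±x₁, …, ±xₙ}` generated by `n` vectors of `ℝⁿ`
(with its Euclidean structure). It is a cross-polytope, non-degenerate exactly when the
`xᵢ` are linearly independent. -/
def symHull {n : ℕ} (x : Fin n → EuclideanSpace ℝ (Fin n)) :
    Set (EuclideanSpace ℝ (Fin n)) :=
  convexHull ℝ (Set.range x ∪ Set.range fun i => -x i)

/-- The set of positions `i` among the last `k` (indices are `0, …, n - 1`) such that the
`i`-th vector of the list lies within Euclidean distance `h` of the linear span of the
vectors that precede it. -/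
def closePositions {n : ℕ} (k : ℕ) (h : ℝ) (x : Fin n → EuclideanSpace ℝ (Fin n)) :
    Set (Fin n) :=
  {i | n - k ≤ (i : ℕ) ∧
    Metric.infDist (x i) (Submodule.span ℝ (x '' {j | j < i}) : Set _) ≤ h}

/-- The class of tilted cross-polytopes with parameters `k` and `h` (meant for `1 ≤ k ≤ n` and
`0 < h`): origin-symmetric cross-polytopes such that, for every ordering of the generating
vectors, at least `k / 4` of the last `k` vectors are within distance `h` of the span of the
vectors that precede them. -/
def crosspol (n k : ℕ) (h : ℝ) : Set (Set (EuclideanSpace ℝ (Fin n))) :=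
  {T | ∃ x : Fin n → EuclideanSpace ℝ (Fin n), T = symHull x ∧
    ∀ σ : Equiv.Perm (Fin n), (k : ℝ) / 4 ≤ ((closePositions k h (x ∘ σ)).ncard : ℝ)}

/-!
Suppose that the `xᵢ` span the space (otherwise the polytope lies in a proper subspace, which is
null), and let `aᵢ` be the coordinates of a Gaussian vector `G` in the basis `x`. If `G` lies in
the polytope then `∑ |aᵢ| ≤ 1`, so at most `n / 16` of the `aᵢ` exceed `16 / n` in absolute value.

For a fixed ordering, the Gram–Schmidt basis `e` of `x` makes the coordinate functionals
triangular: `aᵢ` depends only on `⟪eⱼ, G⟫` with `j ≥ i`, and the coefficient of `⟪eᵢ, G⟫` is at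
least `1 / h` in absolute value when `xᵢ` is within `h` of the span of its predecessors. Fubini's
theorem then bounds the probability that `|aᵢ| ≤ t` for all `i` in a set `S` of close positions by
`(t * h) ^ |S|` (`stdGaussian_repr_le`). A union bound over at most `2 ^ k` sets `S` with
`|S| ≥ k / 8` shows that it is exponentially unlikely that at most `k / 8` of the close positions
carry a large coefficient (`stdGaussian_few_large_le`).

A union bound over all orderings would be too expensive for `k` much smaller than `n`. Instead the
orderings are averaged: among the `n` cyclic shifts of a given ordering, at least half put at most
`k / 8` large coefficients into the last `k` positions (`card_shifts_few_large_le`). So every point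
of the polytope lies in at least half of the `n` unlikely events attached to the shifts, and the
measure of the polytope is at most twice the largest of their probabilities
(`measure_le_two_mul_of_card`).
-/

open scoped ENNReal

/-! ### Small ball estimates for triangular systems of Gaussians -/

/-- The standard Gaussian density is at most `1 / 2`, and the set is an interval of length
`2 * t / |m|`. -/
theorem gaussianReal_slab_le {m s t h : ℝ} (hm : 1 ≤ h * |m|) :
    gaussianReal 0 1 {u | |m * u + s| ≤ t} ≤ ENNReal.ofReal (t * h) := by
  have hm0 : 0 < |m| := by
    rcases (abs_nonneg m).eq_or_lt with h0 | h0
    · rw [← h0] at hm; norm_num at hm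
    · exact h0
  have hsub : {u | |m * u + s| ≤ t} ⊆ Metric.closedBall (-s / m) (t * h) := by
    intro u hu
    simp only [Set.mem_ofPred_eq] at hu
    rw [Metric.mem_closedBall, Real.dist_eq]
    have e : m * u + s = m * (u - -s / m) := by
      have : m ≠ 0 := abs_pos.mp hm0
      field_simp
      ring
    rw [e, abs_mul] at hu
    calc |u - -s / m| ≤ (h * |m|) * |u - -s / m| := le_mul_of_one_le_left (abs_nonneg _) hm
      _ = h * (|m| * |u - -s / m|) := by ring
      _ ≤ h * t := by
        refine mul_le_mul_of_nonneg_left hu ?_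
        by_contra hneg
        nlinarith
      _ = t * h := mul_comm _ _
  refine (measure_mono hsub).trans ?_
  rw [gaussianReal_apply _ one_ne_zero]
  calc ∫⁻ x in Metric.closedBall (-s / m) (t * h), gaussianPDF 0 1 x
      ≤ ∫⁻ _ in Metric.closedBall (-s / m) (t * h), ENNReal.ofReal (1 / 2) := by
        refine lintegral_mono fun x => ENNReal.ofReal_le_ofReal ?_
        rw [gaussianPDFReal_def]
        have h2 : (2 : ℝ) ≤ √(2 * Real.pi * (1 : NNReal)) := by
          apply Real.le_sqrt_of_sq_le
          have := Real.pi_gt_three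
          norm_num
          linarith
        have h3 : (√(2 * Real.pi * (1 : NNReal)))⁻¹ ≤ 1 / 2 := by
          rw [one_div]
          exact inv_anti₀ (by norm_num) h2
        refine (mul_le_of_le_one_right (by positivity) ?_).trans h3
        apply Real.exp_le_one_iff.2
        have : 0 ≤ (x - 0) ^ 2 / (2 * ((1 : NNReal) : ℝ)) := by positivity
        rw [neg_div]
        linarith
    _ = ENNReal.ofReal (t * h) := by
        rw [setLIntegral_const, Real.volume_closedBall, ← ENNReal.ofReal_mul (by norm_num)]
        congr 1
        ring

/-- A product small ball bound for the rows, indexed by `S`, of an upper triangular matrix applied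
to a vector of independent standard Gaussians. -/
theorem pi_gaussianReal_triangular_le {t h : ℝ} :
    ∀ (n : ℕ) (M : Fin n → Fin n → ℝ) (S : Finset (Fin n)), (∀ i j, j < i → M i j = 0) →
      (∀ i ∈ S, 1 ≤ h * |M i i|) →
      Measure.pi (fun _ : Fin n => gaussianReal 0 1) {g | ∀ i ∈ S, |∑ j, M i j * g j| ≤ t} ≤
        ENNReal.ofReal (t * h) ^ S.card := by
  intro n
  induction n with
  | zero =>
    intro M S _ _
    have : S = ∅ := Finset.eq_empty_of_isEmpty S
    subst this
    simp
  | succ n ih =>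
    intro M S hM hS
    -- Rows `1, …, n` do not involve the coordinate `0`: once the other coordinates are fixed, only
    -- row `0` constrains it.
    set S' : Finset (Fin n) := Finset.univ.filter fun i => i.succ ∈ S with hS'
    set A : Set (Fin n → ℝ) := {g | ∀ i ∈ S', |∑ j, M i.succ j.succ * g j| ≤ t} with hA
    have hAm : MeasurableSet A := by
      rw [hA]
      simp only [Set.ofPred_forall]
      exact MeasurableSet.iInter fun i => MeasurableSet.iInter fun _ =>
        measurableSet_le (by fun_prop) measurable_const
    have hAle := ih (fun i j => M i.succ j.succ) S'
      (fun i j hij => hM _ _ (Fin.succ_lt_succ_iff.2 hij))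
      (fun i hi => hS _ (Finset.mem_filter.1 hi).2)
    set B : Set (ℝ × (Fin n → ℝ)) :=
      {p | p.2 ∈ A ∧ (0 ∈ S → |M 0 0 * p.1 + ∑ j : Fin n, M 0 j.succ * p.2 j| ≤ t)} with hB
    have hBm : MeasurableSet B := by
      refine (measurable_snd hAm).inter ?_
      by_cases h0 : 0 ∈ S
      · simp only [h0, forall_const]
        exact measurableSet_le (by fun_prop) measurable_const
      · simp only [h0, false_imp_iff]
        exact MeasurableSet.univ
    have hmp := measurePreserving_piFinSuccAbove (fun _ : Fin (n + 1) => gaussianReal 0 1) 0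
    have hpre : {g : Fin (n + 1) → ℝ | ∀ i ∈ S, |∑ j, M i j * g j| ≤ t} ⊆
        MeasurableEquiv.piFinSuccAbove (fun _ : Fin (n + 1) => ℝ) 0 ⁻¹' B := by
      intro g hg
      simp only [Set.mem_ofPred_eq] at hg
      refine ⟨fun i hi => ?_, fun h0 => ?_⟩
      · have := hg _ (Finset.mem_filter.1 hi).2
        rw [Fin.sum_univ_succ, hM _ _ (Fin.succ_pos i), zero_mul, zero_add] at this
        exact this
      · have := hg 0 h0
        rw [Fin.sum_univ_succ] at this
        exact this
    refine (measure_mono hpre).trans ?_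
    rw [hmp.measure_preimage hBm.nullMeasurableSet, Measure.prod_apply_symm hBm]
    set q : ℝ≥0∞ := if 0 ∈ S then ENNReal.ofReal (t * h) else 1 with hq
    have hsec : ∀ y, gaussianReal 0 1 ((fun x => (x, y)) ⁻¹' B) ≤ A.indicator (fun _ => q) y := by
      intro y
      by_cases hy : y ∈ A
      · rw [Set.indicator_of_mem hy]
        by_cases h0 : 0 ∈ S
        · simp only [hq, h0, if_true]
          refine (measure_mono ?_).trans
            (gaussianReal_slab_le (s := ∑ j : Fin n, M 0 j.succ * y j) (hS 0 h0))
          exact fun u hu => hu.2 h0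
        · simp only [hq, h0, if_false]
          exact prob_le_one
      · have : (fun x => (x, y)) ⁻¹' B = ∅ := by
          ext x
          simp [hB, hy]
        rw [this, measure_empty]
        exact zero_le
    refine (lintegral_mono hsec).trans ?_
    rw [lintegral_indicator hAm, setLIntegral_const]
    have hcard : q * ENNReal.ofReal (t * h) ^ S'.card = ENNReal.ofReal (t * h) ^ S.card := by
      have hSeq : S.card = (if 0 ∈ S then 1 else 0) + S'.card := by
        have h1 : S.card = ∑ i : Fin (n + 1), if i ∈ S then 1 else 0 := by simp
        rw [h1, Fin.sum_univ_succ, hS', Finset.card_filter]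
      rw [hSeq, pow_add]
      by_cases h0 : 0 ∈ S <;> simp [hq, h0]
    rw [← hcard]
    exact mul_le_mul_right hAle q

/-! ### Coordinates of a Gaussian vector in a basis -/

section Basis

variable {n : ℕ} {E : Type*} [NormedAddCommGroup E] [InnerProductSpace ℝ E]
  [FiniteDimensional ℝ E] [MeasurableSpace E] [BorelSpace E]

/-- It is unlikely that many coordinates in the basis `b` are small, if the corresponding basis
vectors are close to the span of the preceding ones. -/
theorem stdGaussian_repr_le (b : Module.Basis (Fin n) ℝ E) {t h : ℝ} (S : Finset (Fin n))
    (hS : ∀ i ∈ S, Metric.infDist (b i) (Submodule.span ℝ (b '' {j | j < i}) : Set E) ≤ h) :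
    stdGaussian E {G | ∀ i ∈ S, |b.repr G i| ≤ t} ≤ ENNReal.ofReal (t * h) ^ S.card := by
  have hfr : Module.finrank ℝ E = Fintype.card (Fin n) := Module.finrank_eq_card_basis b
  set e := InnerProductSpace.gramSchmidtOrthonormalBasis hfr b with he
  have he' : ∀ i, e i = InnerProductSpace.gramSchmidtNormed ℝ b i := fun i =>
    InnerProductSpace.gramSchmidtOrthonormalBasis_apply hfr (by
      have := InnerProductSpace.gramSchmidtNormed_unit_length i b.linearIndependent
      intro h0
      rw [h0, norm_zero] at this
      exact zero_ne_one this)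
  have htri : ∀ i j, j < i → b.repr (e j) i = 0 := by
    intro i j hij
    rw [he', InnerProductSpace.gramSchmidtNormed, map_smul, Finsupp.smul_apply,
      InnerProductSpace.gramSchmidt_triangular hij b, smul_zero]
  have hvan : ∀ i, ∀ p ∈ Submodule.span ℝ (b '' {j | j < i}), b.repr p i = 0 := by
    intro i p hp
    by_contra hne
    exact lt_irrefl i (b.mem_span_image.1 hp (Finsupp.mem_support_iff.2 hne))
  have hdiag : ∀ i ∈ S, 1 ≤ h * |b.repr (e i) i| := by
    intro i hi
    -- The functional `b.repr · i` takes the value `1` at `b i - p`, and on the span of the `b j` with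
    -- `j ≤ i` it equals `⟪e i, ·⟫` up to the factor `b.repr (e i) i`.
    have key : ∀ p ∈ Submodule.span ℝ (b '' {j | j < i}),
        1 ≤ dist (b i) p * |b.repr (e i) i| := by
      intro p hp
      have h1 : b.repr (b i - p) i = 1 := by
        simp [hvan i p hp]
      have h2 : ∀ j, i < j → inner ℝ (e j) (b i - p) = 0 := by
        intro j hij
        clear h1
        rw [inner_sub_right, InnerProductSpace.gramSchmidtOrthonormalBasis_inv_triangular hfr b hij,
          zero_sub, neg_eq_zero]
        induction hp using Submodule.span_induction with
        | mem v hv =>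
          obtain ⟨l, hl, rfl⟩ := hv
          exact InnerProductSpace.gramSchmidtOrthonormalBasis_inv_triangular hfr b (lt_trans hl hij)
        | zero => simp
        | add u v _ _ hu hv => rw [inner_add_right, hu, hv, add_zero]
        | smul a v _ hv => rw [inner_smul_right, hv, mul_zero]
      have h3 : b.repr (b i - p) i = inner ℝ (e i) (b i - p) * b.repr (e i) i := by
        conv_lhs => rw [← e.sum_repr' (b i - p)]
        rw [map_sum, Finsupp.finsetSum_apply, Finset.sum_eq_single i]
        · simp
        · intro j _ hji
          rcases lt_or_gt_of_ne hji with hlt | hgt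
          · simp [htri i j hlt]
          · simp [h2 j hgt]
        · simp
      calc (1 : ℝ) = |inner ℝ (e i) (b i - p)| * |b.repr (e i) i| := by
            rw [← abs_mul, ← h3, h1, abs_one]
        _ ≤ dist (b i) p * |b.repr (e i) i| := by
            refine mul_le_mul_of_nonneg_right ?_ (abs_nonneg _)
            have := abs_real_inner_le_norm (e i) (b i - p)
            rwa [e.orthonormal.1 i, one_mul, ← dist_eq_norm] at this
    have hpos : 0 < |b.repr (e i) i| := by
      rcases (abs_nonneg (b.repr (e i) i)).eq_or_lt with h0 | h0
      · have := key 0 (zero_mem _)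
        rw [← h0] at this
        norm_num at this
      · exact h0
    rw [← div_le_iff₀ hpos]
    refine le_trans ?_ (hS i hi)
    refine (Metric.le_infDist ⟨0, zero_mem (Submodule.span ℝ _)⟩).2 fun p hp => ?_
    exact (div_le_iff₀ hpos).2 (key p hp)
  rw [stdGaussian_eq_map_pi_orthonormalBasis e, Measure.map_apply (by fun_prop)]
  · refine le_trans (measure_mono ?_) (pi_gaussianReal_triangular_le n
      (fun i j => b.repr (e j) i) S htri hdiag)
    intro g hg i hi
    have := hg i hi
    rw [map_sum, Finsupp.finsetSum_apply] at this
    simpa [mul_comm] using this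
  · simp only [Set.ofPred_forall]
    refine MeasurableSet.iInter fun i => MeasurableSet.iInter fun _ =>
      measurableSet_le ?_ measurable_const
    exact (LinearMap.continuous_of_finiteDimensional (b.coord i)).measurable.abs

/-- Union bound over the set of `i ∈ C` at which the coordinate is small. -/
theorem stdGaussian_few_large_le (b : Module.Basis (Fin n) ℝ E) {k : ℕ} {t h : ℝ}
    (hth : t * h ≤ (1 / 2) ^ 10) (C : Finset (Fin n)) (hCk : C.card ≤ k) (hkC : k ≤ 4 * C.card)
    (hC : ∀ i ∈ C, Metric.infDist (b i) (Submodule.span ℝ (b '' {j | j < i}) : Set E) ≤ h) :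
    stdGaussian E {G | 8 * (C.filter fun i => t < |b.repr G i|).card ≤ k} ≤
      ENNReal.ofReal (Real.exp (-(1 / 16384 * k))) := by
  have hcover : {G : E | 8 * (C.filter fun i => t < |b.repr G i|).card ≤ k} ⊆
      ⋃ S ∈ C.powerset.filter (fun S => k ≤ 8 * S.card), {G | ∀ i ∈ S, |b.repr G i| ≤ t} := by
    intro G hG
    simp only [Set.mem_ofPred_eq] at hG
    have hadd := Finset.card_filter_add_card_filter_not (s := C) (fun i => t < |b.repr G i|)
    refine Set.mem_biUnion (x := C.filter fun i => ¬ t < |b.repr G i|) ?_ ?_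
    · refine Finset.mem_coe.2 (Finset.mem_filter.2
        ⟨Finset.mem_powerset.2 (Finset.filter_subset _ _), ?_⟩)
      omega
    · intro i hi
      exact not_lt.1 (Finset.mem_filter.1 hi).2
  -- At most `2 ^ k` sets, each contributing at most `2 ^ (-10 * |S|) ≤ 2 ^ (-(10 / 8) * k)`.
  have hl2 := Real.log_two_gt_d9
  have hpow : ∀ m : ℕ, (1 / 2 : ℝ) ^ m = Real.exp (-(m * Real.log 2)) := by
    intro m
    rw [Real.exp_neg, Real.exp_nat_mul, Real.exp_log two_pos, one_div, inv_pow]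
  have hterm : ∀ S ∈ C.powerset.filter (fun S => k ≤ 8 * S.card),
      stdGaussian E {G | ∀ i ∈ S, |b.repr G i| ≤ t} ≤
        ENNReal.ofReal (Real.exp (-(10 / 8 * k * Real.log 2))) := by
    intro S hS
    obtain ⟨hSC, hSk⟩ := Finset.mem_filter.1 hS
    refine (stdGaussian_repr_le b S fun i hi => hC i (Finset.mem_powerset.1 hSC hi)).trans ?_
    calc ENNReal.ofReal (t * h) ^ S.card ≤ ENNReal.ofReal ((1 / 2) ^ 10) ^ S.card := by
          gcongr
      _ = ENNReal.ofReal ((1 / 2) ^ (10 * S.card)) := by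
          rw [← ENNReal.ofReal_pow (by positivity), ← pow_mul]
      _ ≤ _ := by
          refine ENNReal.ofReal_le_ofReal ?_
          rw [hpow, Real.exp_le_exp, neg_le_neg_iff]
          refine mul_le_mul_of_nonneg_right ?_ (by linarith)
          have : (k : ℝ) ≤ 8 * S.card := by exact_mod_cast hSk
          push_cast
          linarith
  calc stdGaussian E {G | 8 * (C.filter fun i => t < |b.repr G i|).card ≤ k}
      ≤ ∑ S ∈ C.powerset.filter (fun S => k ≤ 8 * S.card),
          stdGaussian E {G | ∀ i ∈ S, |b.repr G i| ≤ t} :=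
        (measure_mono hcover).trans (measure_biUnion_finset_le _ _)
    _ ≤ (C.powerset.filter (fun S => k ≤ 8 * S.card)).card •
          ENNReal.ofReal (Real.exp (-(10 / 8 * k * Real.log 2))) :=
        Finset.sum_le_card_nsmul _ _ _ hterm
    _ ≤ (2 ^ k : ℕ) • ENNReal.ofReal (Real.exp (-(10 / 8 * k * Real.log 2))) := by
        refine nsmul_le_nsmul_left zero_le ?_
        refine (Finset.card_filter_le _ _).trans ?_
        rw [Finset.card_powerset]
        exact Nat.pow_le_pow_right two_pos hCk
    _ = ENNReal.ofReal (Real.exp (k * Real.log 2) *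
          Real.exp (-(10 / 8 * k * Real.log 2))) := by
        rw [← ENNReal.ofReal_nsmul, nsmul_eq_mul, Real.exp_nat_mul, Real.exp_log two_pos]
        norm_num
    _ ≤ _ := by
        refine ENNReal.ofReal_le_ofReal ?_
        rw [← Real.exp_add, Real.exp_le_exp]
        have : (0 : ℝ) ≤ k := Nat.cast_nonneg k
        nlinarith

theorem stdGaussian_submodule_eq_zero {W : Submodule ℝ E} (hW : W ≠ ⊤) :
    stdGaussian E (W : Set E) = 0 := by
  obtain ⟨f, hf, hle⟩ := W.exists_le_ker_of_lt_top (lt_top_iff_ne_top.2 hW)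
  set L : StrongDual ℝ E := LinearMap.toContinuousLinearMap f with hL
  have hL0 : L ≠ 0 := by
    intro h0
    apply hf
    ext v
    exact DFunLike.congr_fun h0 v
  have hsub : (W : Set E) ⊆ L ⁻¹' {0} := fun v hv => hle hv
  refine measure_mono_null hsub ?_
  rw [← Measure.map_apply L.measurable (measurableSet_singleton 0), IsGaussian.map_eq_gaussianReal,
    variance_dual_stdGaussian]
  have : (‖L‖ ^ 2).toNNReal ≠ 0 := by
    rw [Ne, Real.toNNReal_eq_zero, not_le]
    have := norm_pos_iff.2 hL0
    positivity
  have := nullSingletonClass_gaussianReal (μ := ∫ x, L x ∂stdGaussian E) this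
  exact measure_singleton 0

end Basis

/-! ### Averaging over cyclic shifts -/

theorem card_last_positions {n k : ℕ} (hkn : k ≤ n) :
    (Finset.univ.filter fun i : Fin n => n - k ≤ (i : ℕ)).card = k := by
  have hadd := Finset.card_filter_add_card_filter_not
    (s := (Finset.univ : Finset (Fin n))) (fun i => (i : ℕ) < n - k)
  simp only [not_lt, Fin.card_filter_val_lt, Finset.card_univ, Fintype.card_fin] at hadd
  omega

/-- For at least half of the cyclic shifts, at most `k / 8` of the last `k` positions carry an entry
larger than `16 / n`: there are at most `n / 16` such entries, each of which occupies one of the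
last `k` positions for exactly `k` shifts, so that Markov's inequality applies. -/
theorem card_shifts_few_large_le {n : ℕ} [NeZero n] {k : ℕ} (hk : 1 ≤ k) (hkn : k ≤ n)
    {a : Fin n → ℝ} (ha : ∑ i, |a i| ≤ 1) :
    n ≤ 2 * (Finset.univ.filter fun r : Fin n => 8 * (Finset.univ.filter
      fun i : Fin n => n - k ≤ (i : ℕ) ∧ 16 / (n : ℝ) < |a (i + r)|).card ≤ k).card := by
  set N : Fin n → ℕ := fun r => (Finset.univ.filter
      fun i : Fin n => n - k ≤ (i : ℕ) ∧ 16 / (n : ℝ) < |a (i + r)|).card with hN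
  set B : Finset (Fin n) := Finset.univ.filter fun i => 16 / (n : ℝ) < |a i| with hB
  have hn : (0 : ℝ) < n := Nat.cast_pos.2 (Nat.pos_of_ne_zero (NeZero.ne n))
  have hBc : 16 * B.card ≤ n := by
    have h1 : B.card • (16 / (n : ℝ)) ≤ ∑ i ∈ B, |a i| :=
      Finset.card_nsmul_le_sum _ _ _ fun i hi => (Finset.mem_filter.1 hi).2.le
    have h2 : ∑ i ∈ B, |a i| ≤ 1 := le_trans
      (Finset.sum_le_sum_of_subset_of_nonneg (Finset.subset_univ _) fun i _ _ => abs_nonneg _) ha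
    have h3 := h1.trans h2
    rw [nsmul_eq_mul, mul_div_assoc', div_le_one hn] at h3
    have : ((16 * B.card : ℕ) : ℝ) ≤ n := by push_cast; linarith
    exact_mod_cast this
  have hsum : ∑ r, N r = k * B.card := by
    simp only [hN, Finset.card_filter]
    rw [Finset.sum_comm]
    have : ∀ i : Fin n, (∑ r : Fin n,
        if n - k ≤ (i : ℕ) ∧ 16 / (n : ℝ) < |a (i + r)| then 1 else 0) =
        if n - k ≤ (i : ℕ) then B.card else 0 := by
      intro i
      by_cases hi : n - k ≤ (i : ℕ)
      · simp only [hi, true_and, if_true]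
        rw [hB, Finset.card_filter]
        exact Fintype.sum_equiv (Equiv.addLeft i) _ _ fun r => rfl
      · simp [hi]
    rw [Finset.sum_congr rfl fun i _ => this i, ← Finset.sum_filter, Finset.sum_const,
      card_last_positions hkn,
      smul_eq_mul]
  have hbad : (Finset.univ.filter fun r => ¬ 8 * N r ≤ k).card * k ≤ 8 * ∑ r, N r := by
    rw [← smul_eq_mul, Finset.mul_sum]
    refine (Finset.card_nsmul_le_sum _ (fun r => 8 * N r) _ fun r hr =>
      (not_le.1 (Finset.mem_filter.1 hr).2).le).trans ?_
    exact Finset.sum_le_sum_of_subset (Finset.subset_univ _)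
  have hadd := Finset.card_filter_add_card_filter_not
    (s := (Finset.univ : Finset (Fin n))) (fun r => 8 * N r ≤ k)
  rw [Finset.card_univ, Fintype.card_fin] at hadd
  have hbad' : (Finset.univ.filter fun r => ¬ 8 * N r ≤ k).card ≤ 8 * B.card := by
    rw [hsum] at hbad
    refine Nat.le_of_mul_le_mul_right (hbad.trans (le_of_eq ?_)) hk
    ring
  change n ≤ 2 * (Finset.univ.filter fun r => 8 * N r ≤ k).card
  omega

/-- If every point of `P` lies in at least half of the sets `A r`, then the measure of `P` is at most
twice the largest measure of an `A r`. -/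
theorem measure_le_two_mul_of_card {Ω : Type*} [MeasurableSpace Ω] (μ : Measure Ω) {n : ℕ}
    [NeZero n] {P : Set Ω} {A : Fin n → Set Ω} (hA : ∀ r, MeasurableSet (A r)) {p : ℝ≥0∞}
    (hp : ∀ r, μ (A r) ≤ p)
    (h : ∀ ω ∈ P, ∀ (_ : DecidablePred fun r => ω ∈ A r),
      n ≤ 2 * (Finset.univ.filter fun r => ω ∈ A r).card) : μ P ≤ 2 * p := by
  classical
  have hsub : P ⊆ {ω | (n : ℝ≥0∞) ≤ 2 * ∑ r, (A r).indicator 1 ω} := by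
    intro ω hω
    have := h ω hω inferInstance
    simp only [Set.mem_ofPred_eq, Set.indicator_apply, Pi.one_apply, Finset.sum_boole]
    exact_mod_cast this
  have hmeas : Measurable fun ω => 2 * ∑ r, (A r).indicator (1 : Ω → ℝ≥0∞) ω :=
    (Finset.measurable_sum _ fun r _ => measurable_one.indicator (hA r)).const_mul 2
  have hn : (n : ℝ≥0∞) ≠ 0 := Nat.cast_ne_zero.2 (NeZero.ne n)
  have hmk := mul_meas_ge_le_lintegral (μ := μ) hmeas n
  rw [lintegral_const_mul _ (Finset.measurable_sum _ fun r _ => measurable_one.indicator (hA r)),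
    lintegral_finsetSum _ fun r _ => measurable_one.indicator (hA r)] at hmk
  simp only [lintegral_indicator_one (hA _)] at hmk
  have h1 : (n : ℝ≥0∞) * μ P ≤ n * (2 * p) := by
    refine (mul_le_mul_right (measure_mono hsub) _).trans (hmk.trans ?_)
    calc 2 * ∑ r, μ (A r) ≤ 2 * ∑ _r : Fin n, p := by gcongr; exact hp _
      _ = n * (2 * p) := by
        rw [Finset.sum_const, Finset.card_univ, Fintype.card_fin, nsmul_eq_mul]
        ring
  exact (ENNReal.mul_le_mul_iff_right hn (ENNReal.natCast_ne_top n)).1 h1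

/-! ### Points of the polytope -/

theorem symHull_subset_span {n : ℕ} (x : Fin n → EuclideanSpace ℝ (Fin n)) :
    symHull x ⊆ Submodule.span ℝ (Set.range x) := by
  refine convexHull_min (Set.union_subset Submodule.subset_span ?_) (Submodule.convex _)
  rintro _ ⟨i, rfl⟩
  exact neg_mem (Submodule.subset_span ⟨i, rfl⟩)

theorem sum_abs_repr_le_one_of_mem_symHull {n : ℕ}
    (b : Module.Basis (Fin n) ℝ (EuclideanSpace ℝ (Fin n))) {G : EuclideanSpace ℝ (Fin n)}
    (hG : G ∈ symHull b) : ∑ i, |b.repr G i| ≤ 1 := by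
  have hconv : Convex ℝ {G | ∑ i, |b.repr G i| ≤ 1} := by
    intro u hu v hv α β hα hβ hαβ
    simp only [Set.mem_ofPred_eq] at *
    calc ∑ i, |b.repr (α • u + β • v) i| ≤ ∑ i, (α * |b.repr u i| + β * |b.repr v i|) := by
          refine Finset.sum_le_sum fun i _ => ?_
          rw [map_add, map_smul, map_smul, Finsupp.add_apply, Finsupp.smul_apply,
            Finsupp.smul_apply, smul_eq_mul, smul_eq_mul]
          refine (abs_add_le _ _).trans (le_of_eq ?_)
          rw [abs_mul, abs_mul, abs_of_nonneg hα, abs_of_nonneg hβ]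
      _ = α * ∑ i, |b.repr u i| + β * ∑ i, |b.repr v i| := by
          rw [Finset.sum_add_distrib, Finset.mul_sum, Finset.mul_sum]
      _ ≤ 1 := by nlinarith
  have hone : ∀ i, ∑ j, |b.repr (b i) j| = 1 := by
    intro i
    rw [Finset.sum_eq_single i] <;> simp +contextual [eq_comm]
  refine convexHull_min (Set.union_subset ?_ ?_) hconv hG
  · rintro _ ⟨i, rfl⟩
    exact (hone i).le
  · rintro _ ⟨i, rfl⟩
    simp only [Set.mem_ofPred_eq, map_neg, Finsupp.neg_apply, abs_neg]
    exact (hone i).le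

theorem lemmal :
    ∃ c : ℝ, 0 < c ∧
      ∀ (n k : ℕ) (h : ℝ), 1 ≤ k → k ≤ n → 0 < h → h ≤ c * n →
        ∀ P ∈ crosspol n k h,
          (stdGaussian (EuclideanSpace ℝ (Fin n))).real P ≤ 2 * Real.exp (-(c * k)) := by
  -- `1 / 16384 = 2 ^ (-14)`, so that `(16 / n) * h ≤ 2 ^ (-10)`.
  refine ⟨1 / 16384, by norm_num, ?_⟩
  rintro n k h hk hkn hh hhn _ ⟨x, rfl, hx⟩
  have : NeZero n := ⟨by omega⟩
  have hn : (0 : ℝ) < n := Nat.cast_pos.2 (by omega)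
  refine ENNReal.toReal_le_of_le_ofReal (by positivity) ?_
  rw [ENNReal.ofReal_mul zero_le_two, ENNReal.ofReal_ofNat]
  by_cases hspan : Submodule.span ℝ (Set.range x) = ⊤
  swap
  · rw [measure_mono_null (symHull_subset_span x) (stdGaussian_submodule_eq_zero hspan)]
    exact zero_le
  obtain ⟨b, rfl⟩ : ∃ b : Module.Basis (Fin n) ℝ (EuclideanSpace ℝ (Fin n)), ⇑b = x :=
    ⟨basisOfTopLeSpanOfCardEqFinrank x hspan.ge (by simp), by simp⟩
  classical
  let C : Fin n → Finset (Fin n) := fun r =>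
    (closePositions k h (b ∘ Equiv.addRight r)).toFinset
  have hmemC : ∀ r i, i ∈ C r ↔ i ∈ closePositions k h (b ∘ Equiv.addRight r) := fun r i =>
    Set.mem_toFinset
  let A : Fin n → Set (EuclideanSpace ℝ (Fin n)) := fun r =>
    {G | 8 * ((C r).filter fun i => 16 / (n : ℝ) < |b.repr G (i + r)|).card ≤ k}
  refine measure_le_two_mul_of_card _ (A := A) ?_ ?_ ?_
  · intro r
    have hm : Measurable fun G : EuclideanSpace ℝ (Fin n) =>
        8 * ((C r).filter fun i => 16 / (n : ℝ) < |b.repr G (i + r)|).card := by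
      simp only [Finset.card_filter]
      refine (Finset.measurable_sum _ fun i _ => Measurable.ite ?_ measurable_const
        measurable_const).const_mul 8
      exact measurableSet_lt measurable_const
        (LinearMap.continuous_of_finiteDimensional (b.coord (i + r))).measurable.abs
    exact measurableSet_le hm measurable_const
  · intro r
    have hb : ⇑(b.reindex (Equiv.addRight r).symm) = b ∘ Equiv.addRight r := by
      ext i : 1
      simp
    have key := stdGaussian_few_large_le (b.reindex (Equiv.addRight r).symm) (k := k)
      (t := 16 / n) (h := h) ?_ (C r) ?_ ?_ ?_
    · simpa only [Module.Basis.repr_reindex_apply, Equiv.symm_symm, Equiv.coe_addRight] using key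
    · calc 16 / (n : ℝ) * h ≤ 16 / (n : ℝ) * (1 / 16384 * n) := by gcongr
        _ = (1 / 2) ^ 10 := by field_simp; norm_num
    · refine le_trans (Finset.card_le_card fun i hi => ?_) (card_last_positions hkn).le
      exact Finset.mem_filter.2 ⟨Finset.mem_univ _, ((hmemC r i).1 hi).1⟩
    · have := hx (Equiv.addRight r)
      rw [Set.ncard_eq_toFinset_card'] at this
      have h4 : (k : ℝ) ≤ ((4 * (C r).card : ℕ) : ℝ) := by
        push_cast
        linarith
      exact_mod_cast h4
    · intro i hi
      rw [hb]
      exact ((hmemC r i).1 hi).2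
  · intro G hG _
    refine (card_shifts_few_large_le hk hkn (sum_abs_repr_le_one_of_mem_symHull b hG)).trans ?_
    refine Nat.mul_le_mul_left 2 (Finset.card_le_card fun r hr => ?_)
    refine Finset.mem_filter.2 ⟨Finset.mem_univ _, ?_⟩
    refine le_trans (Nat.mul_le_mul_left 8 (Finset.card_le_card fun i hi => ?_))
      (Finset.mem_filter.1 hr).2
    obtain ⟨hi1, hi2⟩ := Finset.mem_filter.1 hi
    exact Finset.mem_filter.2 ⟨Finset.mem_univ _, ((hmemC r i).1 hi1).1, hi2⟩
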